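/- Let $\mathfrak{g}=\mathfrak{g}_1\oplus\mathfrak{g}_2$ be a finite-dimensional real $2$-step stratified Lie algebra, i.e. $[\mathfrak{g}_1,\mathfrak{g}_1]=\mathfrak{g}_2\neq\{0\}$ and $[\mathfrak{g},\mathfrak{g}_2]=\{0\}$, and let $\langle\cdot,\cdot\rangle$ be an inner product on $\mathfrak{g}_1$. For $\eta$ in the dual space $\mathfrak{g}_2^*$ let $J_\eta$ be the unique endomorphism of $\mathfrak{g}_1$ such that $\langle J_\eta x,x'\rangle=\eta([x,x'])$ for all $x,x'\in\mathfrak{g}_1$. Suppose that we are in the case (37D), that is, $\dim\mathfrak{g}_1=4$, $\dim\mathfrak{g}_2=3$, and there exist an orthonormal basis of $\mathfrak{g}_1$ and linear coordinates $(\eta_1,\eta_2,\eta_3)$ on $\mathfrak{g}_2^*$ such that the Pfaffian of the (skewsymmetric) matrix of $J_\eta$ in this basis is $$\operatorname{Pf} J_\eta=\eta_1^2+\eta_2^2-\eta_3^2\qquad\text{for all }\eta\in\mathfrak{g}_2^*.$$ Let $|\cdot|$ denote the norm of $\langle\cdot,\cdot\rangle$ on $\mathfrak{g}_1$, as well as the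 norm of an arbitrary fixed inner product on $\mathfrak{g}_2^*$. Then there exists a continuous function $w:\mathfrak{g}_1\to[0,\infty)$ such that: (i) for all $\eta\in\mathfrak{g}_2^*$ and $x\in\mathfrak{g}_1$, $|J_\eta x|\geq|\eta|\,w(x)$; (ii) for all $\alpha,\gamma\in[0,\infty)$ with $\min\{\gamma,1\}+\alpha>\dim\mathfrak{g}_1$, $$\int_{\mathfrak{g}_1}(1+|x|)^{-\alpha}\,(1+w(x))^{-\gamma}\,dx<\infty .$$ -/

import Mathlib

/-- The algebraic data of a `2`-step stratified group with a homogeneous sublaplacian: a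
stratification `𝔤 = 𝔤₁ ⊕ 𝔤₂` of the real Lie algebra `𝔤`, with `[𝔤₁, 𝔤₁] = 𝔤₂ ≠ 0` and
`[𝔤, 𝔤₂] = 0`, and an inner product on the first layer `𝔤₁`. -/
structure TwoStepStratification (𝔤 : Type*) [LieRing 𝔤] [LieAlgebra ℝ 𝔤] where
  /-- The first layer `𝔤₁`. -/
  fst : Submodule ℝ 𝔤
  /-- The second layer `𝔤₂`. -/
  snd : Submodule ℝ 𝔤
  isCompl : IsCompl fst snd
  span_bracket : Submodule.span ℝ {z : 𝔤 | ∃ x ∈ fst, ∃ y ∈ fst, ⁅x, y⁆ = z} = snd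
  snd_ne_bot : snd ≠ ⊥
  bracket_snd : ∀ x : 𝔤, ∀ u ∈ snd, ⁅x, u⁆ = 0
  /-- The inner product on the first layer. -/
  innerFst : InnerProductSpace.Core ℝ fst

namespace TwoStepStratification

variable {𝔤 : Type*} [LieRing 𝔤] [LieAlgebra ℝ 𝔤] (S : TwoStepStratification 𝔤)

/-- The first layer as a Euclidean space, normed by its inner product. -/
noncomputable instance instNormedAddCommGroupFst : NormedAddCommGroup S.fst :=
  S.innerFst.toNormedAddCommGroup

noncomputable instance instInnerProductSpaceFst : InnerProductSpace ℝ S.fst :=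
  InnerProductSpace.ofCore S.innerFst.toCore

noncomputable instance instMeasurableSpaceFst : MeasurableSpace S.fst := borel S.fst

instance instBorelSpaceFst : BorelSpace S.fst := ⟨rfl⟩

/-- The bracket of two elements of the first layer, as an element of the second layer. -/
def bracketFst : S.fst →ₗ[ℝ] S.fst →ₗ[ℝ] S.snd :=
  LinearMap.mk₂ ℝ
    (fun x y => ⟨⁅(x : 𝔤), (y : 𝔤)⁆,
      S.span_bracket ▸ Submodule.subset_span ⟨x, x.2, y, y.2, rfl⟩⟩)
    (fun x y z => by ext; simp)
    (fun c x y => by ext; simp)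
    (fun x y z => by ext; simp)
    (fun c x y => by ext; simp)

@[simp] theorem coe_bracketFst (x y : S.fst) :
    (S.bracketFst x y : 𝔤) = ⁅(x : 𝔤), (y : 𝔤)⁆ := rfl

variable [FiniteDimensional ℝ 𝔤]

instance instFiniteDimensionalFst : FiniteDimensional ℝ S.fst :=
  FiniteDimensional.finiteDimensional_submodule S.fst

/-- For `η` in the dual of the second layer, `J η` is the unique endomorphism of the first layer
such that `⟪J η x, x'⟫ = η [x, x']` for all `x, x'` in the first layer. -/
noncomputable def J (η : Module.Dual ℝ S.snd) : S.fst →ₗ[ℝ] S.fst where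
  toFun x := (InnerProductSpace.toDual ℝ S.fst).symm
    (LinearMap.toContinuousLinearMap (η ∘ₗ S.bracketFst x))
  map_add' x y := by
    rw [← map_add, ← map_add]; congr 2; ext z; simp
  map_smul' c x := by
    rw [RingHom.id_apply]
    refine ext_inner_right ℝ fun z => ?_
    simp [real_inner_smul_left]

theorem inner_J (η : Module.Dual ℝ S.snd) (x x' : S.fst) :
    inner ℝ (S.J η x) x' = η (S.bracketFst x x') := by
  simp [J]

/-- `S` is of type (37D): `dim 𝔤₁ = 4`, `dim 𝔤₂ = 3` and, for a suitable orthonormal basis of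
`𝔤₁` and suitable linear coordinates `(η₁, η₂, η₃)` on the dual of `𝔤₂`, the Pfaffian of the
skewsymmetric `4 × 4` matrix of `J η` is `η₁² + η₂² - η₃²`. -/
def IsType37D : Prop :=
  Module.finrank ℝ S.fst = 4 ∧ Module.finrank ℝ S.snd = 3 ∧
  ∃ (e : OrthonormalBasis (Fin 4) ℝ S.fst) (c : Module.Basis (Fin 3) ℝ (Module.Dual ℝ S.snd)),
    ∀ η : Module.Dual ℝ S.snd,
      let M : Matrix (Fin 4) (Fin 4) ℝ := LinearMap.toMatrix e.toBasis e.toBasis (S.J η)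
      M 0 1 * M 2 3 - M 0 2 * M 1 3 + M 0 3 * M 1 2
        = c.repr η 0 ^ 2 + c.repr η 1 ^ 2 - c.repr η 2 ^ 2

end TwoStepStratification

/-! The Pfaffian restricted to the forms `J η` has signature (2,1), so it has null directions `A`,
`B` that are not orthogonal, and a non-null `C` orthogonal to both. Then ℝ⁴ = ker `B` ⊕ ker `A`,
where `A` lives on the first plane, `B` on the second, and `C` pairs the two planes
(`exists_basis_normalForm`). In adapted coordinates z put q = z₀z₂ + z₁z₃. For η = aA + bB + cC,
pairing J_η x with suitable vectors of length O(|x|) isolates aq, bq and cq up to constants, so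
|η||q(x)| ≤ K|x||J_η x| (`IsType37D.exists_norm_mul_le`), and w = |q| / (K(1 + |x|)) works. For the
integral, where |zᵢ| is the largest coordinate, q / zᵢ is the partner coordinate of zᵢ plus a
function of the other three. Hence w controls a sheared coordinate, and Fubini with a translation
applies (`integrable_shear`, `integrable_hyperbolicForm`). -/

/-- The Pfaffian of a skewsymmetric `4 × 4` matrix. -/
def pfaffianFour (M : Matrix (Fin 4) (Fin 4) ℝ) : ℝ :=
  M 0 1 * M 2 3 - M 0 2 * M 1 3 + M 0 3 * M 1 2

/-- The polar form of the Pfaffian on `4 × 4` matrices. -/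
def pfaffianFourPolar (M N : Matrix (Fin 4) (Fin 4) ℝ) : ℝ :=
  M 0 1 * N 2 3 + N 0 1 * M 2 3 - M 0 2 * N 1 3 - N 0 2 * M 1 3 + M 0 3 * N 1 2 + N 0 3 * M 1 2

/-- The Hodge dual of a skewsymmetric `4 × 4` matrix. -/
def hodgeFour (M : Matrix (Fin 4) (Fin 4) ℝ) : Matrix (Fin 4) (Fin 4) ℝ :=
  !![0, M 2 3, -M 1 3, M 1 2;
    -M 2 3, 0, M 0 3, -M 0 2;
    M 1 3, -M 0 3, 0, M 0 1;
    -M 1 2, M 0 2, -M 0 1, 0]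

/-! ### Alternating forms on ℝ⁴ and their Pfaffian -/

section Skew

open Matrix

variable {A B C M N : Matrix (Fin 4) (Fin 4) ℝ}

theorem pfaffianFourPolar_comm : pfaffianFourPolar M N = pfaffianFourPolar N M := by
  unfold pfaffianFourPolar; ring

theorem pfaffianFourPolar_self : pfaffianFourPolar M M = 2 * pfaffianFour M := by
  unfold pfaffianFourPolar pfaffianFour; ring

theorem pfaffianFour_add :
    pfaffianFour (M + N) = pfaffianFour M + pfaffianFour N + pfaffianFourPolar M N := by
  simp only [pfaffianFourPolar, pfaffianFour, Matrix.add_apply]; ring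

theorem hodgeFour_transpose : (hodgeFour M)ᵀ = -hodgeFour M := by
  ext i j; fin_cases i <;> fin_cases j <;> simp [hodgeFour]

/-- A Clifford-type relation, the polarization of M(⋆M) = -Pf(M). All the later linear algebra rests
on it and its transpose. -/
theorem mul_hodgeFour_add (hM : Mᵀ = -M) (hN : Nᵀ = -N) :
    M * hodgeFour N + N * hodgeFour M = -pfaffianFourPolar M N • 1 := by
  have h1 (i j) : M i j = -M j i := by simpa using congrFun₂ hM j i
  have h2 (i j) : N i j = -N j i := by simpa using congrFun₂ hN j i
  have d1 (i) : M i i = 0 := by linarith [h1 i i]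
  have d2 (i) : N i i = 0 := by linarith [h2 i i]
  ext i j
  fin_cases i <;> fin_cases j <;>
    simp [hodgeFour, mul_apply, Fin.sum_univ_four, pfaffianFourPolar, d1, d2, h1 1 0, h1 2 0,
      h1 3 0, h1 2 1, h1 3 1, h1 3 2, h2 1 0, h2 2 0, h2 3 0, h2 2 1, h2 3 1, h2 3 2] <;> ring

theorem hodgeFour_mul_add (hM : Mᵀ = -M) (hN : Nᵀ = -N) :
    hodgeFour M * N + hodgeFour N * M = -pfaffianFourPolar M N • 1 := by
  have := congrArg transpose (mul_hodgeFour_add hM hN)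
  simp only [transpose_add, transpose_mul, hM, hN, hodgeFour_transpose, transpose_smul,
    transpose_one, neg_mul_neg] at this
  rw [← this, add_comm]

theorem mul_hodgeFour_self (hM : Mᵀ = -M) : M * hodgeFour M = -pfaffianFour M • 1 := by
  have h := mul_hodgeFour_add hM hM
  rw [pfaffianFourPolar_self, ← two_smul ℝ, neg_mul_eq_mul_neg, mul_smul] at h
  exact smul_right_injective _ two_ne_zero h

theorem hodgeFour_mul_self (hM : Mᵀ = -M) : hodgeFour M * M = -pfaffianFour M • 1 := by
  have h := hodgeFour_mul_add hM hM
  rw [pfaffianFourPolar_self, ← two_smul ℝ, neg_mul_eq_mul_neg, mul_smul] at h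
  exact smul_right_injective _ two_ne_zero h

theorem dotProduct_mulVec_skew (hM : Mᵀ = -M) (x y : Fin 4 → ℝ) :
    x ⬝ᵥ M *ᵥ y = -(y ⬝ᵥ M *ᵥ x) := by
  rw [dotProduct_mulVec, ← mulVec_transpose, hM, neg_mulVec, neg_dotProduct, dotProduct_comm]

/-- For two null forms that are not orthogonal, every vector is congruent modulo the kernel of the
first to one in the kernel of the second. -/
theorem exists_mulVec_eq_of_null (hA : Aᵀ = -A) (hB : Bᵀ = -B) (pA : pfaffianFour A = 0)
    (pB : pfaffianFour B = 0) (pAB : pfaffianFourPolar A B ≠ 0) (x : Fin 4 → ℝ) :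
    ∃ u, B *ᵥ u = 0 ∧ A *ᵥ u = A *ᵥ x := by
  refine ⟨(-(pfaffianFourPolar A B)⁻¹) • (hodgeFour B *ᵥ (A *ᵥ x)), ?_, ?_⟩
  · rw [mulVec_smul, mulVec_mulVec, mul_hodgeFour_self hB, pB]; simp
  · have h := mul_hodgeFour_add hA hB
    -- Swapping the first two factors by the Clifford relation leaves a term ending in (⋆A)A =
    -- -Pf(A) = 0.
    have : A * hodgeFour B * A = -pfaffianFourPolar A B • A := by
      rw [eq_sub_of_add_eq h, sub_mul, mul_assoc, hodgeFour_mul_self hA, pA]; simp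
    rw [mulVec_smul, mulVec_mulVec, mulVec_mulVec, this, smul_mulVec, smul_smul]
    simp [pAB]

/-- A form orthogonal to `B` vanishes on the kernel of `B`. -/
theorem dotProduct_mulVec_eq_zero_of_ker (hA : Aᵀ = -A) (hB : Bᵀ = -B) (hC : Cᵀ = -C)
    (pAB : pfaffianFourPolar A B ≠ 0) (pBC : pfaffianFourPolar B C = 0) {u v : Fin 4 → ℝ}
    (hu : B *ᵥ u = 0) (hv : B *ᵥ v = 0) : u ⬝ᵥ C *ᵥ v = 0 := by
  -- As `B` kills `u`, this exhibits `u` as a multiple of (⋆B)Au. Moving the skew ⋆B across the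
  -- pairing meets (⋆B)Cv, which is 0 by orthogonality.
  have h1 := congrArg (· *ᵥ u) (hodgeFour_mul_add hA hB)
  simp only [add_mulVec, ← mulVec_mulVec, hu, mulVec_zero, zero_add, smul_mulVec,
    one_mulVec] at h1
  have h2 := congrArg (· *ᵥ v) (hodgeFour_mul_add hB hC)
  simp only [add_mulVec, ← mulVec_mulVec, hv, mulVec_zero, add_zero, pBC,
    neg_zero, zero_smul] at h2
  have h3 : (hodgeFour B *ᵥ A *ᵥ u) ⬝ᵥ C *ᵥ v = 0 := by
    rw [dotProduct_comm, dotProduct_mulVec, ← mulVec_transpose, hodgeFour_transpose,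
      neg_mulVec, h2]
    simp
  rw [h1, smul_dotProduct, smul_eq_mul] at h3
  exact (mul_eq_zero.1 h3).resolve_left (neg_ne_zero.2 pAB)

theorem eq_zero_of_mulVec_eq_zero (hC : Cᵀ = -C) (pC : pfaffianFour C ≠ 0) {v : Fin 4 → ℝ}
    (hv : C *ᵥ v = 0) : v = 0 := by
  have h := congrArg (· *ᵥ v) (hodgeFour_mul_self hC)
  simp only [← mulVec_mulVec, hv, mulVec_zero, smul_mulVec, one_mulVec] at h
  exact (smul_eq_zero.1 h.symm).resolve_left (neg_ne_zero.2 pC)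

theorem exists_dotProduct_mulVec_ne_zero (h : M ≠ 0) : ∃ x y, x ⬝ᵥ M *ᵥ y ≠ 0 := by
  by_contra! H
  exact h (Matrix.ext fun i j => by simpa using H (Pi.single i 1) (Pi.single j 1))

/-- Pairing a linear relation through `A` with `f 0`, `f 1`, and through `B` with `f 2`, `f 3`,
isolates one coefficient at a time. -/
theorem linearIndependent_of_kers (hA : Aᵀ = -A) (hB : Bᵀ = -B) {f : Fin 4 → Fin 4 → ℝ}
    (h0 : B *ᵥ f 0 = 0) (h1 : B *ᵥ f 1 = 0) (h2 : A *ᵥ f 2 = 0) (h3 : A *ᵥ f 3 = 0)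
    (h01 : f 0 ⬝ᵥ A *ᵥ f 1 ≠ 0) (h23 : f 2 ⬝ᵥ B *ᵥ f 3 ≠ 0) : LinearIndependent ℝ f := by
  rw [Fintype.linearIndependent_iff]
  intro g hg
  have h10 := dotProduct_mulVec_skew hA (f 1) (f 0)
  have h32 := dotProduct_mulVec_skew hB (f 3) (f 2)
  have s1 := dotProduct_mulVec_skew hA (f 0) (f 0)
  have s2 := dotProduct_mulVec_skew hA (f 1) (f 1)
  have s3 := dotProduct_mulVec_skew hB (f 2) (f 2)
  have s4 := dotProduct_mulVec_skew hB (f 3) (f 3)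
  have s1' : f 0 ⬝ᵥ A *ᵥ f 0 = 0 := by linarith
  have s2' : f 1 ⬝ᵥ A *ᵥ f 1 = 0 := by linarith
  have s3' : f 2 ⬝ᵥ B *ᵥ f 2 = 0 := by linarith
  have s4' : f 3 ⬝ᵥ B *ᵥ f 3 = 0 := by linarith
  have e0 := congrArg (fun v => f 0 ⬝ᵥ A *ᵥ v) hg
  have e1 := congrArg (fun v => f 1 ⬝ᵥ A *ᵥ v) hg
  have e2 := congrArg (fun v => f 2 ⬝ᵥ B *ᵥ v) hg
  have e3 := congrArg (fun v => f 3 ⬝ᵥ B *ᵥ v) hg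
  simp only [Fin.sum_univ_four, mulVec_add, mulVec_smul, dotProduct_add, dotProduct_smul, h0, h1,
    h2, h3, h10, h32, s1', s2', s3', s4', dotProduct_zero, mulVec_zero, smul_eq_mul, mul_zero,
    add_zero, zero_add, mul_neg, neg_eq_zero, mul_eq_zero, h01, h23, or_false] at e0 e1 e2 e3
  intro i
  fin_cases i <;> assumption

/-- Normal form of a three-dimensional space of alternating forms on `ℝ⁴` on which the Pfaffian
is nondegenerate and isotropic. -/
theorem exists_basis_normalForm (hA : Aᵀ = -A) (hB : Bᵀ = -B) (hC : Cᵀ = -C)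
    (pA : pfaffianFour A = 0) (pB : pfaffianFour B = 0) (pC : pfaffianFour C ≠ 0)
    (pAB : pfaffianFourPolar A B ≠ 0) (pAC : pfaffianFourPolar A C = 0)
    (pBC : pfaffianFourPolar B C = 0) :
    ∃ (f : Module.Basis (Fin 4) ℝ (Fin 4 → ℝ)) (α β : ℝ), α ≠ 0 ∧ β ≠ 0 ∧
      (∀ i j, f i ⬝ᵥ A *ᵥ f j = !![0, α, 0, 0; -α, 0, 0, 0; 0, 0, 0, 0; 0, 0, 0, 0] i j) ∧
      (∀ i j, f i ⬝ᵥ B *ᵥ f j = !![0, 0, 0, 0; 0, 0, 0, 0; 0, 0, 0, β; 0, 0, -β, 0] i j) ∧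
      (∀ i j, f i ⬝ᵥ C *ᵥ f j = !![0, 0, 1, 0; 0, 0, 0, 1; -1, 0, 0, 0; 0, -1, 0, 0] i j) := by
  have pBA : pfaffianFourPolar B A ≠ 0 := by rwa [pfaffianFourPolar_comm]
  have A0 : A ≠ 0 := by rintro rfl; simp [pfaffianFourPolar] at pAB
  have B0 : B ≠ 0 := by rintro rfl; simp [pfaffianFourPolar] at pAB
  obtain ⟨x, y, hxy⟩ := exists_dotProduct_mulVec_ne_zero A0
  obtain ⟨z, t, hzt⟩ := exists_dotProduct_mulVec_ne_zero B0
  obtain ⟨u, Bu, Au⟩ := exists_mulVec_eq_of_null hA hB pA pB pAB x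
  obtain ⟨v, Bv, Av⟩ := exists_mulVec_eq_of_null hA hB pA pB pAB y
  obtain ⟨r, Ar, Br⟩ := exists_mulVec_eq_of_null hB hA pB pA pBA z
  obtain ⟨s, As, Bs⟩ := exists_mulVec_eq_of_null hB hA pB pA pBA t
  have huv : u ⬝ᵥ A *ᵥ v ≠ 0 := by
    rwa [Av, dotProduct_mulVec_skew hA, Au, ← dotProduct_mulVec_skew hA]
  have hrs : r ⬝ᵥ B *ᵥ s ≠ 0 := by
    rwa [Bs, dotProduct_mulVec_skew hB, Br, ← dotProduct_mulVec_skew hB]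
  have Cuv {a b} (ha : B *ᵥ a = 0) (hb : B *ᵥ b = 0) : a ⬝ᵥ C *ᵥ b = 0 :=
    dotProduct_mulVec_eq_zero_of_ker hA hB hC pAB pBC ha hb
  have Crs {a b} (ha : A *ᵥ a = 0) (hb : A *ᵥ b = 0) : a ⬝ᵥ C *ᵥ b = 0 :=
    dotProduct_mulVec_eq_zero_of_ker hB hA hC pBA pAC ha hb
  have hli : LinearIndependent ℝ ![u, v, r, s] :=
    linearIndependent_of_kers hA hB Bu Bv Ar As huv hrs
  let b := basisOfLinearIndependentOfCardEqFinrank hli (by simp)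
  have hnd (a : Fin 4 → ℝ) (h0 : u ⬝ᵥ C *ᵥ a = 0) (h1 : v ⬝ᵥ C *ᵥ a = 0) (h2 : r ⬝ᵥ C *ᵥ a = 0)
      (h3 : s ⬝ᵥ C *ᵥ a = 0) : a = 0 := by
    refine eq_zero_of_mulVec_eq_zero hC pC (dotProduct_eq_zero_iff.1 fun w => ?_)
    rw [dotProduct_comm, ← b.sum_repr w, Fin.sum_univ_four]
    simp [b, add_dotProduct, h0, h1, h2, h3]
  set m02 := u ⬝ᵥ C *ᵥ r with e02
  set m03 := u ⬝ᵥ C *ᵥ s with e03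
  set m12 := v ⬝ᵥ C *ᵥ r with e12
  set m13 := v ⬝ᵥ C *ᵥ s with e13
  have hsk := dotProduct_mulVec_skew hC
  -- The planes are `C`-isotropic, so a degenerate pairing between them would put a nonzero vector
  -- in the radical of `C`.
  have hD : m02 * m13 - m03 * m12 ≠ 0 := by
    intro hD
    have key (p q : ℝ) (h1 : p * m02 + q * m03 = 0) (h2 : p * m12 + q * m13 = 0) :
        p = 0 ∧ q = 0 := by
      have h := hnd (p • r + q • s) (by simp [mulVec_add, mulVec_smul, ← e02, ← e03, h1])
        (by simp [mulVec_add, mulVec_smul, ← e12, ← e13, h2])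
        (Crs Ar (by simp [mulVec_add, mulVec_smul, Ar, As]))
        (Crs As (by simp [mulVec_add, mulVec_smul, Ar, As]))
      rw [Fintype.linearIndependent_iff] at hli
      have := hli ![0, 0, p, q] (by simpa [Fin.sum_univ_four] using h)
      exact ⟨this 2, this 3⟩
    obtain ⟨h13, h12⟩ := key m13 (-m12) (by linarith) (by ring)
    obtain ⟨h03, h02⟩ := key m03 (-m02) (by ring) (by linarith)
    have hu : u = 0 := hnd u (Cuv Bu Bu) (Cuv Bv Bu) (by rw [hsk, ← e02]; linarith)
      (by rw [hsk, ← e03]; linarith)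
    exact huv (by simp [hu])
  set D := m02 * m13 - m03 * m12 with hDdef
  -- By Cramer's rule, `p`, `q` is the basis of ker `A` that is `C`-dual to `u`, `v`.
  set p := D⁻¹ • (m13 • r - m12 • s) with hp
  set q := D⁻¹ • (m02 • s - m03 • r) with hq
  have Ap : A *ᵥ p = 0 := by simp [hp, mulVec_sub, mulVec_smul, Ar, As]
  have Aq : A *ᵥ q = 0 := by simp [hq, mulVec_sub, mulVec_smul, Ar, As]
  have srr : r ⬝ᵥ B *ᵥ r = 0 := by linarith [dotProduct_mulVec_skew hB r r]
  have sss : s ⬝ᵥ B *ᵥ s = 0 := by linarith [dotProduct_mulVec_skew hB s s]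
  have suu : u ⬝ᵥ A *ᵥ u = 0 := by linarith [dotProduct_mulVec_skew hA u u]
  have svv : v ⬝ᵥ A *ᵥ v = 0 := by linarith [dotProduct_mulVec_skew hA v v]
  have spp : p ⬝ᵥ B *ᵥ p = 0 := by linarith [dotProduct_mulVec_skew hB p p]
  have sqq : q ⬝ᵥ B *ᵥ q = 0 := by linarith [dotProduct_mulVec_skew hB q q]
  have Bpq : p ⬝ᵥ B *ᵥ q = D⁻¹ * (r ⬝ᵥ B *ᵥ s) := by
    have : p ⬝ᵥ B *ᵥ q = D⁻¹ * D⁻¹ * D * (r ⬝ᵥ B *ᵥ s) := by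
      simp only [hp, hq, mulVec_sub, mulVec_smul, dotProduct_sub, dotProduct_smul, sub_dotProduct,
        smul_dotProduct, smul_eq_mul, srr, sss, dotProduct_mulVec_skew hB s r]
      rw [hDdef]; ring
    rw [this]; field_simp
  have Bpq0 : p ⬝ᵥ B *ᵥ q ≠ 0 := by rw [Bpq]; exact mul_ne_zero (inv_ne_zero hD) hrs
  have Cup : u ⬝ᵥ C *ᵥ p = 1 := by
    simp only [hp, mulVec_sub, mulVec_smul, dotProduct_sub, dotProduct_smul, smul_eq_mul, ← e02,
      ← e03]
    field_simp; rw [hDdef]; ring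
  have Cuq : u ⬝ᵥ C *ᵥ q = 0 := by
    simp only [hq, mulVec_sub, mulVec_smul, dotProduct_sub, dotProduct_smul, smul_eq_mul, ← e02,
      ← e03]
    ring
  have Cvp : v ⬝ᵥ C *ᵥ p = 0 := by
    simp only [hp, mulVec_sub, mulVec_smul, dotProduct_sub, dotProduct_smul, smul_eq_mul, ← e12,
      ← e13]
    ring
  have Cvq : v ⬝ᵥ C *ᵥ q = 1 := by
    simp only [hq, mulVec_sub, mulVec_smul, dotProduct_sub, dotProduct_smul, smul_eq_mul, ← e12,
      ← e13]
    field_simp; rw [hDdef]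
  have hli' : LinearIndependent ℝ ![u, v, p, q] :=
    linearIndependent_of_kers hA hB Bu Bv Ap Aq huv Bpq0
  refine ⟨basisOfLinearIndependentOfCardEqFinrank hli' (by simp), _, _, huv, Bpq0, ?_, ?_, ?_⟩ <;>
    intro i j <;> rw [coe_basisOfLinearIndependentOfCardEqFinrank]
  · have := dotProduct_mulVec_skew hA v u
    have hpx (x) : p ⬝ᵥ A *ᵥ x = 0 := by rw [dotProduct_mulVec_skew hA, Ap]; simp
    have hqx (x) : q ⬝ᵥ A *ᵥ x = 0 := by rw [dotProduct_mulVec_skew hA, Aq]; simp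
    fin_cases i <;> fin_cases j <;> simp [Ap, Aq, suu, svv, this, hpx, hqx]
  · have := dotProduct_mulVec_skew hB q p
    have hux (x) : u ⬝ᵥ B *ᵥ x = 0 := by rw [dotProduct_mulVec_skew hB, Bu]; simp
    have hvx (x) : v ⬝ᵥ B *ᵥ x = 0 := by rw [dotProduct_mulVec_skew hB, Bv]; simp
    fin_cases i <;> fin_cases j <;> simp [Bu, Bv, spp, sqq, this, hux, hvx]
  · fin_cases i <;> fin_cases j <;>
      simp [Cuv Bu Bu, Cuv Bu Bv, Cuv Bv Bu, Cuv Bv Bv, Crs Ap Ap, Crs Ap Aq, Crs Aq Ap, Crs Aq Aq,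
        Cup, Cuq, Cvp, Cvq, hsk p u, hsk p v, hsk q u, hsk q v]

end Skew

/-! ### Integrability of the model weight on ℝ⁴ -/

section Integral

open MeasureTheory

/-- The smaller base absorbs both exponents. This separates decay in a coordinate from decay in its
shear, leaving two terms of the form treated by `integrable_shear`. -/
theorem rpow_neg_mul_rpow_neg_le {u v p q : ℝ} (hu : 0 < u) (hv : 0 < v) (hp : 0 ≤ p)
    (hq : 0 ≤ q) : u ^ (-p) * v ^ (-q) ≤ u ^ (-(p + q)) + v ^ (-(p + q)) := by
  rcases le_total u v with h | h
  · calc u ^ (-p) * v ^ (-q) ≤ u ^ (-p) * u ^ (-q) := by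
          gcongr ?_ * ?_
          exact Real.rpow_le_rpow_of_nonpos hu h (by linarith)
      _ = u ^ (-(p + q)) := by rw [← Real.rpow_add hu]; ring_nf
      _ ≤ _ := le_add_of_nonneg_right (by positivity)
  · calc u ^ (-p) * v ^ (-q) ≤ v ^ (-p) * v ^ (-q) := by
          gcongr ?_ * ?_
          exact Real.rpow_le_rpow_of_nonpos hv h (by linarith)
      _ = v ^ (-(p + q)) := by rw [← Real.rpow_add hv]; ring_nf
      _ ≤ _ := le_add_of_nonneg_left (by positivity)

/-- Integrability of a decaying function sheared along one coordinate. -/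
theorem integrable_shear {n : ℕ} (j : Fin (n + 1)) {r s : ℝ} (hr : n < r) (hs : 1 < s)
    {a : (Fin n → ℝ) → ℝ} (ha : Measurable a) :
    Integrable (fun z : Fin (n + 1) → ℝ =>
      (1 + ‖j.removeNth z‖) ^ (-r) * (1 + ‖z j + a (j.removeNth z)‖) ^ (-s)) := by
  have h1 : Integrable (fun t : ℝ => (1 + ‖t‖) ^ (-s)) := integrable_one_add_norm (by simpa)
  have h2 : Integrable (fun y : Fin n → ℝ => (1 + ‖y‖) ^ (-r)) :=
    integrable_one_add_norm (by simpa)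
  have h3 : Integrable (fun p : ℝ × (Fin n → ℝ) =>
      (1 + ‖p.2‖) ^ (-r) * (1 + ‖p.1 + a p.2‖) ^ (-s)) (volume.prod volume) := by
    have hm : Measurable (fun p : ℝ × (Fin n → ℝ) =>
        (1 + ‖p.2‖) ^ (-r) * (1 + ‖p.1 + a p.2‖) ^ (-s)) := by fun_prop
    refine (integrable_prod_iff' hm.aestronglyMeasurable).2 ⟨.of_forall fun y => ?_, ?_⟩
    · exact (h1.comp_add_right (a y)).const_mul ((1 + ‖y‖) ^ (-r))
    -- Translation invariance makes the inner integral independent of the shear.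
    · have (y : Fin n → ℝ) : ∫ t : ℝ, ‖(1 + ‖y‖) ^ (-r) * (1 + ‖t + a y‖) ^ (-s)‖ =
          (1 + ‖y‖) ^ (-r) * ∫ t : ℝ, (1 + ‖t‖) ^ (-s) := by
        rw [← integral_add_right_eq_self (fun t : ℝ => (1 + ‖t‖) ^ (-s)) (a y), ← integral_const_mul]
        refine integral_congr_ae (.of_forall fun t => ?_)
        exact Real.norm_of_nonneg (by positivity)
      simp only [this]
      exact h2.mul_const _
  exact (volume_preserving_piFinSuccAbove (fun _ => ℝ) j).integrable_comp_of_integrable h3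

/-- The hyperbolic quadratic form on `ℝ⁴`. -/
def hyperbolicForm (z : Fin 4 → ℝ) : ℝ := z 0 * z 2 + z 1 * z 3

/-- For m ≥ 1 one divides by x and uses 1 + m ≤ 2m; for m < 1 the sheared coordinate is at most 2.
The factor 1/3 serves both cases, and x = 0 is harmless since the quotient is then 0. -/
theorem hyperbolicForm_bound {m x y u v : ℝ} (hx : |x| = m) (hy : |y| ≤ m)
    (hu : |u| ≤ m) (hv : |v| ≤ m) :
    3⁻¹ * (1 + ‖y + u * v / x‖) ≤ 1 + |x * y + u * v| / (1 + m) := by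
  have hm : 0 ≤ m := hx ▸ abs_nonneg x
  rw [Real.norm_eq_abs]
  rcases le_or_gt 1 m with h | h
  · have hx0 : x ≠ 0 := by rintro rfl; simp at hx; linarith
    have e : y + u * v / x = (x * y + u * v) / x := by field_simp
    rw [e, abs_div, hx]
    have : |x * y + u * v| / m ≤ 2 * (|x * y + u * v| / (1 + m)) := by
      rw [← mul_div_assoc, div_le_div_iff₀ (by linarith) (by linarith)]
      nlinarith [abs_nonneg (x * y + u * v)]
    have h0 : 0 ≤ |x * y + u * v| / (1 + m) := by positivity
    linarith
  · have h1 : |u * v / x| ≤ m := by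
      rcases hm.eq_or_lt with h0 | h0
      · have : x = 0 := abs_eq_zero.1 (hx.trans h0.symm)
        simp [this, hm]
      · rw [abs_div, hx, div_le_iff₀ h0, abs_mul]
        gcongr
    have h2 := abs_add_le y (u * v / x)
    have h0 : 0 ≤ |x * y + u * v| / (1 + m) := by positivity
    linarith

theorem norm_removeNth_le {n : ℕ} (j : Fin (n + 1)) (z : Fin (n + 1) → ℝ) :
    ‖j.removeNth z‖ ≤ ‖z‖ :=
  (pi_norm_le_iff_of_nonneg (norm_nonneg _)).2 fun _ => norm_le_pi_norm z _

theorem integrable_hyperbolicForm {α γ : ℝ} (hγ : 0 ≤ γ) (hγ1 : γ ≤ 1)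
    (h : 4 < γ + α) :
    Integrable (fun z : Fin 4 → ℝ =>
      (1 + ‖z‖) ^ (-α) * (1 + |hyperbolicForm z| / (1 + ‖z‖)) ^ (-γ)) := by
  -- Half the excess goes to each side: r = 3 + δ integrates three coordinates, and t + γ = 1 + δ
  -- the remaining one. Here t ≥ 0 because γ ≤ 1.
  obtain ⟨δ, hδ⟩ : ∃ δ, δ = (γ + α - 4) / 2 := ⟨_, rfl⟩
  have hδ0 : 0 < δ := by linarith
  obtain ⟨r, hr⟩ : ∃ r, r = 3 + δ := ⟨_, rfl⟩
  obtain ⟨t, ht⟩ : ∃ t, t = 1 - γ + δ := ⟨_, rfl⟩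
  have hα : α = r + t := by linarith
  -- `σ j` is the partner of `j` in the hyperbolic form; `κ j`, `l j` are the other pair.
  let σ : Fin 4 → Fin 4 := ![2, 3, 0, 1]
  let κ : Fin 4 → Fin 4 := ![1, 0, 1, 0]
  let l : Fin 4 → Fin 4 := ![3, 2, 3, 2]
  -- The 0 inserted at `j` is never read, as `κ j`, `l j`, `σ j` all differ from `j`.
  let a (j : Fin 4) (y : Fin 3 → ℝ) : ℝ :=
    let z : Fin 4 → ℝ := j.insertNth 0 y
    z (κ j) * z (l j) / z (σ j)
  have ha (j) (z : Fin 4 → ℝ) : a j (j.removeNth z) = z (κ j) * z (l j) / z (σ j) := by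
    have key (i : Fin 4) (hi : i ≠ j) :
        (j.insertNth 0 (j.removeNth z) : Fin 4 → ℝ) i = z i := by
      obtain ⟨k, rfl⟩ := Fin.exists_succAbove_eq hi
      rw [Fin.insertNth_apply_succAbove]; rfl
    simp only [a]
    rw [key, key, key] <;> fin_cases j <;> simp [σ, κ, l]
  have ham (j) : Measurable (a j) := by
    have (i : Fin 4) : Measurable fun y : Fin 3 → ℝ => (j.insertNth 0 y : Fin 4 → ℝ) i := by
      rcases eq_or_ne i j with rfl | hi
      · simp
      · obtain ⟨k, rfl⟩ := Fin.exists_succAbove_eq hi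
        simpa using measurable_pi_apply k
    exact ((this _).mul (this _)).div (this _)
  let G (j : Fin 4) (b : (Fin 3 → ℝ) → ℝ) (z : Fin 4 → ℝ) : ℝ :=
    (1 + ‖j.removeNth z‖) ^ (-r) * (1 + ‖z j + b (j.removeNth z)‖) ^ (-(t + γ))
  have hG (j b) (hb : Measurable b) : Integrable (G j b) :=
    integrable_shear j (by push_cast; linarith) (by linarith) hb
  have hsum : Integrable (fun z => ∑ j, (3⁻¹ : ℝ) ^ (-γ) * (G j 0 z + G j (a j) z)) :=
    integrable_finsetSum _ fun j _ =>
      ((hG j 0 measurable_zero).add (hG j (a j) (ham j))).const_mul _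
  refine hsum.mono' ?_ (.of_forall fun z => ?_)
  · have : Measurable (fun z : Fin 4 → ℝ => hyperbolicForm z) := by
      unfold hyperbolicForm; fun_prop
    exact Measurable.aestronglyMeasurable (by fun_prop)
  have hG0 (j b) : 0 ≤ G j b z := by simp only [G]; positivity
  rw [Real.norm_of_nonneg (by positivity)]
  obtain ⟨i, hi⟩ : ∃ i, ‖z‖ = |z i| := by
    obtain ⟨i, -, hi⟩ := Finset.exists_max_image Finset.univ (fun i => ‖z i‖) ⟨0, by simp⟩
    exact ⟨i, le_antisymm ((pi_norm_le_iff_of_nonneg (norm_nonneg _)).2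
      fun k => hi k (Finset.mem_univ _)) (norm_le_pi_norm z i)⟩
  obtain ⟨j, rfl⟩ : ∃ j, σ j = i := by
    refine ⟨σ i, ?_⟩
    fin_cases i <;> rfl
  refine le_trans ?_ (Finset.single_le_sum (f := fun j => (3⁻¹ : ℝ) ^ (-γ) *
    (G j 0 z + G j (a j) z)) (fun j _ => mul_nonneg (by positivity)
      (add_nonneg (hG0 _ _) (hG0 _ _))) (Finset.mem_univ j))
  have hq : hyperbolicForm z = z (σ j) * z j + z (κ j) * z (l j) := by
    unfold hyperbolicForm
    fin_cases j <;> simp [σ, κ, l] <;> ring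
  have hle (k) : |z k| ≤ ‖z‖ := norm_le_pi_norm z k
  have b1 : (1 + |hyperbolicForm z| / (1 + ‖z‖)) ^ (-γ) ≤
      (3⁻¹ : ℝ) ^ (-γ) * (1 + ‖z j + a j (j.removeNth z)‖) ^ (-γ) := by
    rw [← Real.mul_rpow (by positivity) (by positivity), ha, hq]
    exact Real.rpow_le_rpow_of_nonpos (by positivity)
      (hyperbolicForm_bound hi.symm (hle _) (hle _) (hle _)) (by linarith)
  have b2 : (1 + ‖z‖) ^ (-α) ≤ (1 + ‖j.removeNth z‖) ^ (-r) * (1 + ‖z j‖) ^ (-t) := by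
    rw [hα, neg_add, Real.rpow_add (by positivity)]
    gcongr ?_ * ?_
    · exact Real.rpow_le_rpow_of_nonpos (by positivity)
        (by linarith [norm_removeNth_le j z]) (by linarith)
    · exact Real.rpow_le_rpow_of_nonpos (by positivity) (by linarith [norm_le_pi_norm z j])
        (by linarith)
  have b3 := rpow_neg_mul_rpow_neg_le (u := 1 + ‖z j‖) (v := 1 + ‖z j + a j (j.removeNth z)‖)
    (p := t) (q := γ) (by positivity) (by positivity) (by linarith) hγ
  calc _ ≤ ((1 + ‖j.removeNth z‖) ^ (-r) * (1 + ‖z j‖) ^ (-t)) *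
        ((3⁻¹ : ℝ) ^ (-γ) * (1 + ‖z j + a j (j.removeNth z)‖) ^ (-γ)) := by gcongr
    _ = (3⁻¹ : ℝ) ^ (-γ) * ((1 + ‖j.removeNth z‖) ^ (-r) *
        ((1 + ‖z j‖) ^ (-t) * (1 + ‖z j + a j (j.removeNth z)‖) ^ (-γ))) := by ring
    _ ≤ (3⁻¹ : ℝ) ^ (-γ) * ((1 + ‖j.removeNth z‖) ^ (-r) * ((1 + ‖z j‖) ^ (-(t + γ)) +
        (1 + ‖z j + a j (j.removeNth z)‖) ^ (-(t + γ)))) := by gcongr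
    _ = _ := by simp only [G, Pi.zero_apply, add_zero]; ring

end Integral

/-! ### Normal form of the bracket and the lower bound for `J` -/

namespace TwoStepStratification

open Matrix

variable {𝔤 : Type*} [LieRing 𝔤] [LieAlgebra ℝ 𝔤] (S : TwoStepStratification 𝔤)

theorem bracketFst_skew (x y : S.fst) : S.bracketFst x y = -S.bracketFst y x := by
  ext; simp

variable [FiniteDimensional ℝ 𝔤]

theorem J_add (η η' : Module.Dual ℝ S.snd) : S.J (η + η') = S.J η + S.J η' := by
  ext1 x
  refine ext_inner_right ℝ fun y => ?_
  simp [inner_J, inner_add_left]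

/-- The matrix of `J η` in an orthonormal basis. -/
noncomputable def matrixJ (e : OrthonormalBasis (Fin 4) ℝ S.fst) (η : Module.Dual ℝ S.snd) :
    Matrix (Fin 4) (Fin 4) ℝ :=
  LinearMap.toMatrix e.toBasis e.toBasis (S.J η)

variable (e : OrthonormalBasis (Fin 4) ℝ S.fst)

theorem matrixJ_add (η η' : Module.Dual ℝ S.snd) :
    S.matrixJ e (η + η') = S.matrixJ e η + S.matrixJ e η' := by
  simp [matrixJ, J_add]

theorem matrixJ_apply (η : Module.Dual ℝ S.snd) (i j : Fin 4) :
    S.matrixJ e η i j = η (S.bracketFst (e j) (e i)) := by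
  rw [← inner_J, real_inner_comm, matrixJ, LinearMap.toMatrix_apply]
  simp [OrthonormalBasis.repr_apply_apply]

theorem matrixJ_transpose (η : Module.Dual ℝ S.snd) :
    (S.matrixJ e η)ᵀ = -S.matrixJ e η := by
  ext i j
  rw [transpose_apply, Matrix.neg_apply, matrixJ_apply, matrixJ_apply, bracketFst_skew, map_neg]

theorem apply_bracketFst_equivFun_symm (η : Module.Dual ℝ S.snd) (x y : Fin 4 → ℝ) :
    η (S.bracketFst (e.toBasis.equivFun.symm x) (e.toBasis.equivFun.symm y)) =
      y ⬝ᵥ S.matrixJ e η *ᵥ x := by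
  simp only [Module.Basis.equivFun_symm_apply, OrthonormalBasis.coe_toBasis, map_sum, map_smul,
    LinearMap.sum_apply, LinearMap.smul_apply, smul_eq_mul, dotProduct, mulVec, matrixJ_apply,
    Finset.mul_sum]
  exact Finset.sum_congr rfl fun i _ => Finset.sum_congr rfl fun j _ => by ring

variable {S}

/-- Bases in which the bracket of a stratification of type (37D) takes a normal form. -/
theorem IsType37D.exists_normalForm (hS : S.IsType37D) :
    ∃ (f : Module.Basis (Fin 4) ℝ S.fst) (d : Fin 3 → Module.Dual ℝ S.snd),
      (∀ η, ∃ a b c : ℝ, η = a • d 0 + b • d 1 + c • d 2) ∧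
      ∃ α β : ℝ, α ≠ 0 ∧ β ≠ 0 ∧
      (∀ i j, d 0 (S.bracketFst (f j) (f i)) =
        !![0, α, 0, 0; -α, 0, 0, 0; 0, 0, 0, 0; 0, 0, 0, 0] i j) ∧
      (∀ i j, d 1 (S.bracketFst (f j) (f i)) =
        !![0, 0, 0, 0; 0, 0, 0, 0; 0, 0, 0, β; 0, 0, -β, 0] i j) ∧
      (∀ i j, d 2 (S.bracketFst (f j) (f i)) =
        !![0, 0, 1, 0; 0, 0, 0, 1; -1, 0, 0, 0; 0, -1, 0, 0] i j) := by
  obtain ⟨-, -, e, c, hP⟩ := hS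
  have hP' (η) : pfaffianFour (S.matrixJ e η) =
      c.repr η 0 ^ 2 + c.repr η 1 ^ 2 - c.repr η 2 ^ 2 := hP η
  have hpol (η η') : pfaffianFourPolar (S.matrixJ e η) (S.matrixJ e η') =
      2 * (c.repr η 0 * c.repr η' 0 + c.repr η 1 * c.repr η' 1 - c.repr η 2 * c.repr η' 2) := by
    have h := pfaffianFour_add (M := S.matrixJ e η) (N := S.matrixJ e η')
    rw [← matrixJ_add, hP', hP', hP'] at h
    simp only [map_add, Finsupp.add_apply] at h
    linarith
  -- `c 0 ± c 2` are null vectors of η₁² + η₂² - η₃², not orthogonal to each other; `c 1` is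
  -- orthogonal to both.
  obtain ⟨g, α, β, hα, hβ, hA, hB, hC⟩ := exists_basis_normalForm
    (S.matrixJ_transpose e (c 0 + c 2)) (S.matrixJ_transpose e (c 0 - c 2))
    (S.matrixJ_transpose e (c 1)) (by simp [hP']) (by simp [hP']) (by simp [hP'])
    (by simp [hpol]) (by simp [hpol]) (by simp [hpol])
  refine ⟨g.map e.toBasis.equivFun.symm, ![c 0 + c 2, c 0 - c 2, c 1], fun η => ?_, α, β, hα, hβ,
    fun i j => ?_, fun i j => ?_, fun i j => ?_⟩
  · refine ⟨(c.repr η 0 + c.repr η 2) / 2, (c.repr η 0 - c.repr η 2) / 2, c.repr η 1, ?_⟩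
    conv_lhs => rw [← c.sum_repr η, Fin.sum_univ_three]
    simp only [cons_val_zero, cons_val_one, cons_val]
    module
  · rw [← hA, Module.Basis.map_apply, Module.Basis.map_apply]
    exact S.apply_bracketFst_equivFun_symm e (c 0 + c 2) _ _
  · rw [← hB, Module.Basis.map_apply, Module.Basis.map_apply]
    exact S.apply_bracketFst_equivFun_symm e (c 0 - c 2) _ _
  · rw [← hC, Module.Basis.map_apply, Module.Basis.map_apply]
    exact S.apply_bracketFst_equivFun_symm e (c 1) _ _

/-- The lower bound for `J` in terms of a hyperbolic quadratic form. -/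
theorem IsType37D.exists_norm_mul_le (hS : S.IsType37D) :
    ∃ f : Module.Basis (Fin 4) ℝ S.fst, ∀ p : Seminorm ℝ (Module.Dual ℝ S.snd), ∃ K : ℝ, 0 < K ∧
      ∀ η x, p η * |hyperbolicForm (f.equivFun x)| ≤ K * ‖x‖ * ‖S.J η x‖ := by
  obtain ⟨f, d, hd, α, β, hα, hβ, hA, hB, hC⟩ := hS.exists_normalForm
  refine ⟨f, fun p => ?_⟩
  obtain ⟨K, hK0, hK⟩ : ∃ K : ℝ, 0 ≤ K ∧ ∀ x i, |f.equivFun x i| ≤ K * ‖x‖ := by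
    let F := LinearMap.toContinuousLinearMap (f.equivFun : S.fst →ₗ[ℝ] Fin 4 → ℝ)
    refine ⟨‖F‖, F.opNorm_nonneg, fun x i => ?_⟩
    exact (norm_le_pi_norm (f.equivFun x) i).trans (F.le_opNorm x)
  have test (i j : Fin 4) (s t : ℝ) (η x) (hs : |s| ≤ K * ‖x‖) (ht : |t| ≤ K * ‖x‖) :
      |η (S.bracketFst x (s • f i + t • f j))| ≤ K * (‖f i‖ + ‖f j‖) * (‖x‖ * ‖S.J η x‖) := by
    rw [← inner_J]
    calc _ ≤ ‖S.J η x‖ * ‖s • f i + t • f j‖ := abs_real_inner_le_norm _ _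
      _ ≤ ‖S.J η x‖ * (|s| * ‖f i‖ + |t| * ‖f j‖) := by
        gcongr
        simpa only [norm_smul, Real.norm_eq_abs] using norm_add_le (s • f i) (t • f j)
      _ ≤ ‖S.J η x‖ * (K * ‖x‖ * ‖f i‖ + K * ‖x‖ * ‖f j‖) := by gcongr
      _ = _ := by ring
  -- The summand 1 only ensures positivity, since `p` may vanish.
  refine ⟨1 + p (d 0) * (|α|⁻¹ * (K * (‖f 1‖ + ‖f 0‖))) +
    p (d 1) * (|β|⁻¹ * (K * (‖f 3‖ + ‖f 2‖))) + p (d 2) * (K * (‖f 2‖ + ‖f 3‖)), by positivity,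
    fun η x => ?_⟩
  obtain ⟨a, b, c, rfl⟩ := hd η
  set η := a • d 0 + b • d 1 + c • d 2 with hη
  set z := f.equivFun x with hz
  have hx : x = z 0 • f 0 + z 1 • f 1 + z 2 • f 2 + z 3 • f 3 := by
    rw [← Fin.sum_univ_four (fun i => z i • f i), hz, f.sum_equivFun]
  have form (i j : Fin 4) (s t : ℝ) : η (S.bracketFst x (s • f i + t • f j)) =
      s * ∑ k, z k * (a * d 0 (S.bracketFst (f k) (f i)) + b * d 1 (S.bracketFst (f k) (f i)) +
        c * d 2 (S.bracketFst (f k) (f i))) +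
      t * ∑ k, z k * (a * d 0 (S.bracketFst (f k) (f j)) + b * d 1 (S.bracketFst (f k) (f j)) +
        c * d 2 (S.bracketFst (f k) (f j))) := by
    conv_lhs => rw [hx]
    simp only [hη, Fin.sum_univ_four, map_add, map_smul, LinearMap.add_apply, LinearMap.smul_apply,
      smul_eq_mul]
  -- Each test vector is chosen so that the contributions of the other two basis forms cancel,
  -- leaving a single coefficient times the hyperbolic form.
  have t0 := test 1 0 (z 2) (-z 3) η x (hK _ _) (by rw [abs_neg]; exact hK _ _)
  have t1 := test 3 2 (z 0) (-z 1) η x (hK _ _) (by rw [abs_neg]; exact hK _ _)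
  have t2 := test 2 3 (z 2) (z 3) η x (hK _ _) (hK _ _)
  have e0 : η (S.bracketFst x (z 2 • f 1 + -z 3 • f 0)) = -α * (a * hyperbolicForm z) := by
    rw [form]; simp [hA, hB, hC, Fin.sum_univ_four, hyperbolicForm]; ring
  have e1 : η (S.bracketFst x (z 0 • f 3 + -z 1 • f 2)) = -β * (b * hyperbolicForm z) := by
    rw [form]; simp [hA, hB, hC, Fin.sum_univ_four, hyperbolicForm]; ring
  have e2 : η (S.bracketFst x (z 2 • f 2 + z 3 • f 3)) = -(c * hyperbolicForm z) := by
    rw [form]; simp [hA, hB, hC, Fin.sum_univ_four, hyperbolicForm]; ring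
  rw [e0, abs_mul, abs_neg, ← le_inv_mul_iff₀ (abs_pos.2 hα), abs_mul] at t0
  rw [e1, abs_mul, abs_neg, ← le_inv_mul_iff₀ (abs_pos.2 hβ), abs_mul] at t1
  rw [e2, abs_neg, abs_mul] at t2
  have hp : p η ≤ |a| * p (d 0) + |b| * p (d 1) + |c| * p (d 2) := by
    refine (map_add_le_add p _ _).trans (add_le_add ((map_add_le_add p _ _).trans ?_) ?_) <;>
      simp [map_smul_eq_mul]
  calc p η * |hyperbolicForm z|
      ≤ (|a| * p (d 0) + |b| * p (d 1) + |c| * p (d 2)) * |hyperbolicForm z| := by gcongr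
    _ = p (d 0) * (|a| * |hyperbolicForm z|) + p (d 1) * (|b| * |hyperbolicForm z|) +
        p (d 2) * (|c| * |hyperbolicForm z|) := by ring
    _ ≤ p (d 0) * (|α|⁻¹ * (K * (‖f 1‖ + ‖f 0‖) * (‖x‖ * ‖S.J η x‖))) +
        p (d 1) * (|β|⁻¹ * (K * (‖f 3‖ + ‖f 2‖) * (‖x‖ * ‖S.J η x‖))) +
        p (d 2) * (K * (‖f 2‖ + ‖f 3‖) * (‖x‖ * ‖S.J η x‖)) := by gcongr
    _ ≤ 1 * (‖x‖ * ‖S.J η x‖) + (p (d 0) * (|α|⁻¹ * (K * (‖f 1‖ + ‖f 0‖) * (‖x‖ * ‖S.J η x‖))) +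
        p (d 1) * (|β|⁻¹ * (K * (‖f 3‖ + ‖f 2‖) * (‖x‖ * ‖S.J η x‖))) +
        p (d 2) * (K * (‖f 2‖ + ‖f 3‖) * (‖x‖ * ‖S.J η x‖))) :=
        le_add_of_nonneg_left (by positivity)
    _ = _ := by ring

end TwoStepStratification

/-! ### Transfer of integrability to the first layer -/

section Transfer

open MeasureTheory

/-- Integrability for additive Haar measures is invariant under linear isomorphisms. -/
theorem integrable_comp_continuousLinearEquiv {E F : Type*} [NormedAddCommGroup E]
    [NormedSpace ℝ E] [MeasurableSpace E] [BorelSpace E] [NormedAddCommGroup F] [NormedSpace ℝ F]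
    [MeasurableSpace F] [BorelSpace F] [FiniteDimensional ℝ F] (L : E ≃L[ℝ] F) (μ : Measure E)
    [μ.IsAddHaarMeasure] (ν : Measure F) [ν.IsAddHaarMeasure] {g : F → ℝ} (hg : Integrable g ν) :
    Integrable (g ∘ L) μ := by
  have : (μ.map L).IsAddHaarMeasure := L.isAddHaarMeasure_map μ
  refine (L.toHomeomorph.measurableEmbedding.integrable_map_iff (μ := μ) (g := g)).1 ?_
  change Integrable g (μ.map L)
  rw [Measure.isAddLeftInvariant_eq_smul (μ.map L) ν]
  exact hg.smul_measure_nnreal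

theorem integrable_hyperbolicForm_comp {E : Type*} [NormedAddCommGroup E] [NormedSpace ℝ E]
    [MeasurableSpace E] [BorelSpace E] (μ : Measure E) [μ.IsAddHaarMeasure]
    (L : E ≃L[ℝ] (Fin 4 → ℝ)) {K : ℝ} (hK : 0 < K) {α γ : ℝ} (hα : 0 ≤ α) (hγ : 0 ≤ γ)
    (h : 4 < min γ 1 + α) :
    Integrable (fun x => (1 + ‖x‖) ^ (-α) *
      (1 + |hyperbolicForm (L x)| / (K * (1 + ‖x‖))) ^ (-γ)) μ := by
  obtain ⟨C, hC1, hC, hC'⟩ : ∃ C : ℝ, 1 ≤ C ∧ (∀ x, ‖L x‖ ≤ C * ‖x‖) ∧ ∀ x, ‖x‖ ≤ C * ‖L x‖ := by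
    refine ⟨max 1 (max ‖(L : E →L[ℝ] Fin 4 → ℝ)‖ ‖(L.symm : (Fin 4 → ℝ) →L[ℝ] E)‖),
      le_max_left _ _, fun x => ?_, fun x => ?_⟩
    · refine ((L : E →L[ℝ] Fin 4 → ℝ).le_opNorm x).trans ?_
      gcongr
      exact (le_max_left _ _).trans (le_max_right _ _)
    · have := (L.symm : (Fin 4 → ℝ) →L[ℝ] E).le_opNorm (L x)
      simp only [ContinuousLinearEquiv.coe_coe, ContinuousLinearEquiv.symm_apply_apply] at this
      refine this.trans ?_
      gcongr
      exact (le_max_right _ _).trans (le_max_right _ _)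
  have hint := (integrable_comp_continuousLinearEquiv L μ volume
    (integrable_hyperbolicForm (α := α) (le_min hγ zero_le_one) (min_le_right γ 1) h)).const_mul
      ((C⁻¹) ^ (-α) * ((max 1 (K * C))⁻¹) ^ (-min γ 1))
  refine hint.mono' ?_ (.of_forall fun x => ?_)
  · have hcont : Continuous fun x => hyperbolicForm (L x) := by
      unfold hyperbolicForm; fun_prop
    refine Continuous.aestronglyMeasurable (.mul ?_ ?_)
    · exact (by fun_prop : Continuous fun x : E => 1 + ‖x‖).rpow_const
        fun x => .inl (by positivity)
    · refine Continuous.rpow_const ?_ fun x => .inl (by positivity)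
      exact continuous_const.add (hcont.abs.div (by fun_prop) fun x => by positivity)
  have hC0 : 0 < C := by linarith
  rw [Real.norm_of_nonneg (by positivity), Function.comp_apply]
  have b1 : (1 + ‖x‖) ^ (-α) ≤ C⁻¹ ^ (-α) * (1 + ‖L x‖) ^ (-α) := by
    rw [← Real.mul_rpow (by positivity) (by positivity)]
    refine Real.rpow_le_rpow_of_nonpos (by positivity) ?_ (by linarith)
    rw [inv_mul_le_iff₀ hC0]
    linarith [hC x]
  have b2 : (1 + |hyperbolicForm (L x)| / (K * (1 + ‖x‖))) ^ (-γ) ≤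
      (max 1 (K * C))⁻¹ ^ (-min γ 1) *
        (1 + |hyperbolicForm (L x)| / (1 + ‖L x‖)) ^ (-min γ 1) := by
    -- The base is at least 1, so lowering γ to min(γ, 1) only enlarges the weight.
    calc _ ≤ (1 + |hyperbolicForm (L x)| / (K * (1 + ‖x‖))) ^ (-min γ 1) :=
          Real.rpow_le_rpow_of_exponent_le (le_add_of_nonneg_right (by positivity))
            (neg_le_neg (min_le_left _ _))
      _ ≤ _ := by
          rw [← Real.mul_rpow (by positivity) (by positivity)]
          refine Real.rpow_le_rpow_of_nonpos (by positivity) ?_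
            (neg_nonpos.2 (le_min hγ zero_le_one))
          rw [mul_add, mul_one]
          refine add_le_add (inv_le_one_of_one_le₀ (le_max_left _ _)) ?_
          calc (max 1 (K * C))⁻¹ * (|hyperbolicForm (L x)| / (1 + ‖L x‖))
              ≤ (K * C)⁻¹ * (|hyperbolicForm (L x)| / (1 + ‖L x‖)) := by
                gcongr; exact le_max_right _ _
            _ = |hyperbolicForm (L x)| / (K * (C * (1 + ‖L x‖))) := by field_simp
            _ ≤ _ := by
                gcongr
                linarith [hC' x]
  calc _ ≤ _ := mul_le_mul b1 b2 (by positivity) (by positivity)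
    _ = _ := by ring

end Transfer

/-! ### The norm on the dual and the conclusion -/

/-- The seminorm of an inner product. -/
noncomputable def InnerProductSpace.Core.seminorm {E : Type*} [AddCommGroup E] [Module ℝ E]
    (c : InnerProductSpace.Core ℝ E) : Seminorm ℝ E :=
  letI := c.toNormedAddCommGroup
  letI : NormedSpace ℝ E := InnerProductSpace.Core.toNormedSpace
  normSeminorm ℝ E

theorem InnerProductSpace.Core.seminorm_apply {E : Type*} [AddCommGroup E] [Module ℝ E]
    (c : InnerProductSpace.Core ℝ E) (x : E) : c.seminorm x = Real.sqrt (c.inner x x) := rfl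

theorem mainTheorem11 {𝔤 : Type*} [LieRing 𝔤] [LieAlgebra ℝ 𝔤] [FiniteDimensional ℝ 𝔤]
    (S : TwoStepStratification 𝔤) (hS : S.IsType37D)
    (innerDual : InnerProductSpace.Core ℝ (Module.Dual ℝ S.snd)) :
    ∃ w : S.fst → ℝ, Continuous w ∧ (∀ x, 0 ≤ w x) ∧
      (∀ (η : Module.Dual ℝ S.snd) (x : S.fst),
        ‖S.J η x‖ ≥ Real.sqrt (innerDual.inner η η) * w x) ∧
      ∀ α γ : ℝ, 0 ≤ α → 0 ≤ γ → min γ 1 + α > (Module.finrank ℝ S.fst : ℝ) →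
        MeasureTheory.Integrable
          (fun x : S.fst => (1 + ‖x‖) ^ (-α) * (1 + w x) ^ (-γ)) MeasureTheory.volume := by
  obtain ⟨f, hf⟩ := hS.exists_norm_mul_le
  obtain ⟨K, hK, hJ⟩ := hf innerDual.seminorm
  let L : S.fst ≃L[ℝ] (Fin 4 → ℝ) := f.equivFun.toContinuousLinearEquiv
  -- Dividing by 1 + |x| instead of |x| keeps w continuous at 0 and only weakens the lower bound.
  refine ⟨fun x => |hyperbolicForm (L x)| / (K * (1 + ‖x‖)), ?_, fun x => by positivity,
    fun η x => ?_, fun α γ hα hγ h => ?_⟩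
  · have hcont : Continuous fun x => hyperbolicForm (L x) := by
      unfold hyperbolicForm; fun_prop
    exact hcont.abs.div (by fun_prop) fun x => by positivity
  · rw [ge_iff_le, ← innerDual.seminorm_apply, ← mul_div_assoc, div_le_iff₀ (by positivity)]
    refine (hJ η x).trans ?_
    nlinarith [mul_nonneg hK.le (norm_nonneg (S.J η x))]
  · rw [hS.1] at h
    exact integrable_hyperbolicForm_comp _ L hK hα hγ (by exact_mod_cast h)
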